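/- Let $\Lambda\subset\mathbb{R}^2=\mathbb{C}$ be a uniformly discrete set of sites (distinct sites have distance at least some $\delta>0$), let $N\in\mathbb{N}$, and let $\mathcal H=\ell^2(\Lambda;\mathbb{C}^N)$. Let $P$ be an orthogonal projection on $\mathcal H$ whose matrix elements decay exponentially: there are $C_1,C_2>0$ with $|P_{(x,a),(y,b)}|\le C_1e^{-C_2|x-y|}$ for all sites $x,y$ and internal indices $a,b$. Suppose $P$ is time-reversal symmetric: it commutes with an antiunitary operator $\Theta$ on $\mathcal H$ with $\Theta^2=-1$ that acts on-site (it has no matrix elements between different sites). Let $O_1,O_2\in\mathbb{R}^2$ be two points, at any distance from each other, and let $(s_{x,y})_{x,y\in\Lambda}$ be Peierls phases for a half-flux at $O_1$ and a half-flux at $O_2$, in any gauge. That is, $|s_{x,y}|=1$, $s_{x,x}=1$, $s_{y,x}=\overline{s_{x,y}}$, and for every closed polygon $x_0,x_1,\dots,x_n=x_0$ of sites none of whose edges passes through $O_1$ or $O_2$, $$\prod_{k=0}^{n-1}s_{x_k,x_{k+1}}=(-1)^{w_1+w_2},$$ where $w_i$ is the winding number of the polygon around $O_i$; for closed polygons with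 an edge passing exactly through $O_1$ or $O_2$ it is only required that this product is $1$ or $-1$. Then there is exactly one bounded operator $S$ on $\mathcal H$ with $S_{(x,a),(y,b)}=s_{x,y}P_{(x,a),(y,b)}$. It is self-adjoint. For $\mu\in(0,1)$ let $\overline S=f_\mu(S)$, where $f_\mu(t)=0$ for $t\le\mu$ and $f_\mu(t)=1$ for $t>\mu$. Then, for every $\mu\in(0,1)$ (in particular for $\mu=\tfrac12$), $f_\mu$ is continuous on the spectrum of $S$, the operator $S-\overline S$ is trace class, and its trace $$\operatorname{tr}^v(S):=\operatorname{Tr}(S-\overline S)$$ is exactly an even integer: $\operatorname{tr}^v(S)\equiv 0 \pmod 2$. -/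

import Mathlib

noncomputable section

/-- The one-particle Hilbert space `ℓ²(Λ; ℂᴺ)`: sites `x ∈ Λ` in the plane (identified with `ℂ`),
with `N` internal states (spin, orbital) per site. -/
abbrev LatticeSpace (Λ : Set ℂ) (N : ℕ) : Type :=
  lp (fun _ : Λ × Fin N => ℂ) 2

/-- Bounded operators on `ℓ²(Λ; ℂᴺ)`. -/
abbrev LatticeOp (Λ : Set ℂ) (N : ℕ) : Type :=
  LatticeSpace Λ N →L[ℂ] LatticeSpace Λ N

variable {Λ : Set ℂ} {N : ℕ}

/-- The basis state with internal label `i.2` at the site `i.1`. -/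
def siteKet (i : Λ × Fin N) : LatticeSpace Λ N :=
  lp.single 2 i (1 : ℂ)

/-- The matrix element `A_{ij} = ⟨i, A j⟩` in the site basis. -/
def matEl (A : LatticeOp Λ N) (i j : Λ × Fin N) : ℂ :=
  inner ℂ (siteKet i) (A (siteKet j))

/-- Distinct sites have distance bounded below. -/
def UniformlyDiscrete (Λ : Set ℂ) : Prop :=
  ∃ δ : ℝ, 0 < δ ∧ ∀ x ∈ Λ, ∀ y ∈ Λ, x ≠ y → δ ≤ dist x y

/-- Exponential decay of matrix elements away from the diagonal. -/
def ExpDecay (P : LatticeOp Λ N) : Prop :=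
  ∃ C₁ C₂ : ℝ, 0 < C₁ ∧ 0 < C₂ ∧ ∀ i j : Λ × Fin N,
    ‖matEl P i j‖ ≤ C₁ * Real.exp (-C₂ * dist (i.1 : ℂ) (j.1 : ℂ))

/-- An on-site time reversal: an antiunitary operator with square `-1` that does not
connect different sites. -/
structure IsTimeReversal (Θ : LatticeSpace Λ N ≃ₗᵢ⋆[ℂ] LatticeSpace Λ N) : Prop where
  sq_eq_neg_one : ∀ ψ, Θ (Θ ψ) = -ψ
  onsite : ∀ i j : Λ × Fin N, i.1 ≠ j.1 → inner ℂ (siteKet i) (Θ (siteKet j)) = 0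

/-- The winding number around `O` of the polygon with consecutive corners
`x 0, x 1, …, x n = x 0`: the total directed angle that its edges subtend at `O`, divided by `2π`.
It is meaningful (and then an integer) when no edge passes through `O`; in that case each edge
subtends an angle in `(-π, π)`. -/
def polygonWinding (O : ℂ) (n : ℕ) (x : ℕ → Λ) : ℝ :=
  (∑ k ∈ Finset.range n, Complex.arg (((x (k + 1) : ℂ) - O) / ((x k : ℂ) - O))) / (2 * Real.pi)

/-- The product of the phases along the polygon `x 0, x 1, …, x n = x 0`. -/
def loopPhase (s : Λ → Λ → ℂ) (n : ℕ) (x : ℕ → Λ) : ℂ :=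
  ∏ k ∈ Finset.range n, s (x k) (x (k + 1))

/-- No edge of the polygon `x 0, x 1, …, x n` passes through `O`. -/
def PolygonAvoids (O : ℂ) (n : ℕ) (x : ℕ → Λ) : Prop :=
  ∀ k < n, O ∉ segment ℝ (x k : ℂ) (x (k + 1) : ℂ)

/-- Peierls phases, in an arbitrary gauge, of two half-fluxes at `O₁` and `O₂`.
A closed polygon of sites picks up a factor `-1` for each turn around `O₁` and for each turn
around `O₂`. If an edge passes exactly through a flux, it is not determined on which side it
passes and either sign is admitted. -/
structure IsTwoHalfFluxPhase (O₁ O₂ : ℂ) (s : Λ → Λ → ℂ) : Prop where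
  norm_eq_one : ∀ x y, ‖s x y‖ = 1
  diag : ∀ x, s x x = 1
  conj_symm : ∀ x y, s y x = star (s x y)
  loop : ∀ (n : ℕ) (x : ℕ → Λ), x n = x 0 → PolygonAvoids O₁ n x → PolygonAvoids O₂ n x →
    ∀ w₁ w₂ : ℤ, polygonWinding O₁ n x = w₁ → polygonWinding O₂ n x = w₂ →
      loopPhase s n x = (-1) ^ (w₁ + w₂)
  loop_sign : ∀ (n : ℕ) (x : ℕ → Λ), x n = x 0 → loopPhase s n x = 1 ∨ loopPhase s n x = -1

/-- `S` is the Peierls substitution of `P`: `S_{xy} = s_{xy} P_{xy}`. -/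
def IsPeierls (s : Λ → Λ → ℂ) (P S : LatticeOp Λ N) : Prop :=
  ∀ i j : Λ × Fin N, matEl S i j = s i.1 j.1 * matEl P i j

/-- The function that sends `t ≤ μ` to `0` and `t > μ` to `1`. -/
def flattenFun (μ : ℝ) (t : ℝ) : ℝ :=
  if t ≤ μ then 0 else 1

/-- `S` is self-adjoint and `flattenFun μ` is continuous on its spectrum, so that the
spectral flattening of `S` at `μ` is given by the continuous functional calculus. -/
def IsFlattenable {H : Type*} [NormedAddCommGroup H] [InnerProductSpace ℂ H] [CompleteSpace H]
    (μ : ℝ) (S : H →L[ℂ] H) : Prop :=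
  IsSelfAdjoint S ∧ ContinuousOn (flattenFun μ) (spectrum ℝ S)

/-- The spectral flattening of a self-adjoint operator at the chemical potential `μ`, by functional
calculus. -/
def flatten {H : Type*} [NormedAddCommGroup H] [InnerProductSpace ℂ H] [CompleteSpace H]
    (μ : ℝ) (S : H →L[ℂ] H) : H →L[ℂ] H :=
  cfc (flattenFun μ) S

/-- The absolute value `|A| = (A* A)^{1/2}` of a bounded operator. -/
def opAbs {H : Type*} [NormedAddCommGroup H] [InnerProductSpace ℂ H] [CompleteSpace H]
    (A : H →L[ℂ] H) : H →L[ℂ] H :=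
  CFC.abs A

/-- `A` is trace class: `Tr |A| < ∞`. The diagonal elements of the positive operator `|A|` are
nonnegative and their sum does not depend on the orthonormal basis. -/
def IsTraceClass (A : LatticeOp Λ N) : Prop :=
  Summable fun i : Λ × Fin N => (matEl (opAbs A) i i).re

/-- The trace of a trace class operator, computed in the site basis. -/
def opTrace (A : LatticeOp Λ N) : ℂ :=
  ∑' i : Λ × Fin N, matEl A i i

/-- The trace over vertex states, `Tr (S - flatten S)`. -/
def vertexTrace (μ : ℝ) (S : LatticeOp Λ N) : ℂ :=
  opTrace (S - flatten μ S)

end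

/-! Seen from afar, two half-fluxes make one full flux, which can be gauged away. Call two sites
close if their distance is small against the distances to both fluxes and both are far from `O₁` on
the scale of `dist O₁ O₂`. A closed polygon with close edges winds equally often around `O₁` and
`O₂`, so its phase is `1`; any other closed polygon has phase `±1`. Hence there is a gauge with
signs `t x y`, equal to `1` between close sites (`IsTwoHalfFluxPhase.exists_gauge`).

Moving this gauge from the phases to `P` gives a projection `P'`, with a time reversal `Θ'`, such
that `S` has matrix `t * P'`. The matrix of `P' - S` lives on pairs that are not close, where `|x -
y|` controls the distance of both sites to `O₁`; exponential decay makes it absolutely summable, so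
`P' - S` is nuclear (`summable_of_expDecay`, `exists_isNuclear_matEl`). Then `S² - S` is nuclear, so
the spectrum of `S` can accumulate only at `0` and `1`, and `S - flatten μ S` is a multiple of `S² -
S`.

The diagonals of `S` and `P'` agree, so the vertex trace is `Tr (P' - Q)` with `Q = flatten μ S`. As
the signs are real, `S` and hence `Q` commute with `Θ'`. The operator `(P' - Q)²` commutes with
`P'`, `Q` and `Θ'`; on each of its finite-dimensional eigenspaces for a nonzero eigenvalue, Kramers
degeneracy makes the traces of `P'` and `Q` even, and its kernel contributes nothing
(`exists_tsum_inner_sub_eq_two_mul`). -/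

section

open InnerProductSpace ContinuousLinearMap

/-! ### Nuclear operators and their trace. -/

section Nuclear

universe u

variable {H : Type u} [NormedAddCommGroup H] [InnerProductSpace ℂ H]

/-- Nuclear operators: absolutely convergent series of operators of rank one. -/
def IsNuclear (A : H →L[ℂ] H) : Prop :=
  ∃ (J : Type u) (a b : J → H), (Summable fun j => ‖a j‖ * ‖b j‖) ∧
    HasSum (fun j => rankOne ℂ (a j) (b j)) A

namespace IsNuclear

variable {A B : H →L[ℂ] H}

theorem neg (hA : IsNuclear A) : IsNuclear (-A) := by
  obtain ⟨J, a, b, hs, h⟩ := hA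
  exact ⟨J, fun j => -a j, b, by simpa using hs, by simpa using h.neg⟩

theorem add (hA : IsNuclear A) (hB : IsNuclear B) : IsNuclear (A + B) := by
  obtain ⟨J, a, b, hs, h⟩ := hA
  obtain ⟨J', a', b', hs', h'⟩ := hB
  refine ⟨J ⊕ J', Sum.elim a a', Sum.elim b b', ?_, ?_⟩
  · exact Summable.sum _ hs hs'
  · exact HasSum.sum (f := fun j => rankOne ℂ (Sum.elim a a' j) (Sum.elim b b' j)) h h'

theorem sub (hA : IsNuclear A) (hB : IsNuclear B) : IsNuclear (A - B) := by
  rw [sub_eq_add_neg]; exact hA.add hB.neg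

theorem mul_left (hA : IsNuclear A) (T : H →L[ℂ] H) : IsNuclear (T * A) := by
  obtain ⟨J, a, b, hs, h⟩ := hA
  refine ⟨J, fun j => T (a j), b, ?_, ?_⟩
  · refine Summable.of_nonneg_of_le (fun j => by positivity) (fun j => ?_) (hs.mul_left ‖T‖)
    rw [← mul_assoc]
    gcongr
    exact T.le_opNorm _
  · simpa only [mul_def, comp_rankOne] using h.mul_left T

theorem mul_right [CompleteSpace H] (hA : IsNuclear A) (T : H →L[ℂ] H) : IsNuclear (A * T) := by
  obtain ⟨J, a, b, hs, h⟩ := hA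
  refine ⟨J, a, fun j => adjoint T (b j), ?_, ?_⟩
  · refine Summable.of_nonneg_of_le (fun j => by positivity) (fun j => ?_) (hs.mul_left ‖adjoint T‖)
    rw [mul_left_comm]
    gcongr
    exact ContinuousLinearMap.le_opNorm _ _
  · simpa only [mul_def, rankOne_comp] using h.mul_right T

/-- The series converges in operator norm, so `A` is a norm limit of operators of finite rank. -/
theorem isCompactOperator [CompleteSpace H] (hA : IsNuclear A) : IsCompactOperator A := by
  obtain ⟨J, a, b, hs, h⟩ := hA
  refine isCompactOperator_of_tendsto h (Filter.Eventually.of_forall fun s => ?_)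
  have : ∀ j, rankOne ℂ (a j) (b j) ∈ compactOperator (RingHom.id ℂ) H H := fun j => by
    change IsCompactOperator (rankOne ℂ (a j) (b j))
    rw [rankOne_def']
    have h1 : IsCompactOperator (toSpanSingleton ℂ (a j)) :=
      isCompactOperator_of_locallyCompactSpace_rng _
    exact h1.comp_clm (innerSL ℂ (b j))
  exact Submodule.sum_mem (compactOperator (RingHom.id ℂ) H H) fun j _ => this j

theorem hasSum_inner {J : Type u} {a b : J → H}
    (h : HasSum (fun j => rankOne ℂ (a j) (b j)) A) (x y : H) :
    HasSum (fun j => inner ℂ x (a j) * inner ℂ (b j) y) (inner ℂ x (A y)) := by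
  have h1 := (((innerSL ℂ x).comp (ContinuousLinearMap.apply ℂ H y)).hasSum h)
  simpa [inner_smul_right, mul_comm] using h1

/-- Cauchy–Schwarz followed by Bessel; this is the bound that permits exchanging the two sums in the
trace. -/
theorem summable_inner_mul_inner {K : Type*} {v : K → H} (hv : Orthonormal ℂ v) (x y : H) :
    Summable (fun k => ‖inner ℂ (v k) x‖ * ‖inner ℂ y (v k)‖) ∧
      ∑' k, ‖inner ℂ (v k) x‖ * ‖inner ℂ y (v k)‖ ≤ ‖x‖ * ‖y‖ := by
  have hx := hv.inner_products_summable x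
  have hy := hv.inner_products_summable y
  have hx' := hv.tsum_inner_products_le x
  have hy' := hv.tsum_inner_products_le y
  have key := Real.summable_and_inner_le_Lp_mul_Lq_tsum_of_nonneg (p := 2) (q := 2)
    (f := fun k => ‖inner ℂ (v k) x‖) (g := fun k => ‖inner ℂ y (v k)‖)
    Real.HolderConjugate.two_two (fun _ => norm_nonneg _) (fun _ => norm_nonneg _)
    (by simpa using hx) (by simpa [norm_inner_symm y] using hy)
  refine ⟨key.1, key.2.trans ?_⟩
  have aux : ∀ (t : ℝ) (z : H), 0 ≤ t → t ≤ ‖z‖ ^ 2 → t ^ (1 / (2 : ℝ)) ≤ ‖z‖ := fun t z _ h2 => by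
    rw [← Real.sqrt_eq_rpow]
    exact Real.sqrt_le_iff.2 ⟨norm_nonneg _, h2⟩
  refine mul_le_mul (aux _ _ (tsum_nonneg fun k => by positivity) (by simpa using hx'))
    (aux _ _ (tsum_nonneg fun k => by positivity) ?_)
    (Real.rpow_nonneg (tsum_nonneg fun k => by positivity) _) (norm_nonneg _)
  simpa [norm_inner_symm y] using hy'

theorem summable_prod {K : Type*} {v : K → H} (hv : Orthonormal ℂ v) {J : Type u} {a b : J → H}
    (hs : Summable fun j => ‖a j‖ * ‖b j‖) :
    Summable fun p : J × K => inner ℂ (v p.2) (a p.1) * inner ℂ (b p.1) (v p.2) := by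
  refine Summable.of_norm ?_
  simp only [norm_mul]
  rw [summable_prod_of_nonneg (fun _ => by positivity)]
  refine ⟨fun j => (summable_inner_mul_inner hv (a j) (b j)).1, ?_⟩
  exact Summable.of_nonneg_of_le (fun j => tsum_nonneg fun k => by positivity)
    (fun j => (summable_inner_mul_inner hv (a j) (b j)).2) hs

theorem summable_inner (hA : IsNuclear A) {K : Type*} {v : K → H} (hv : Orthonormal ℂ v) :
    Summable fun k => inner ℂ (v k) (A (v k)) := by
  obtain ⟨J, a, b, hs, h⟩ := hA
  have := (summable_prod hv hs).prod_symm.prod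
  refine this.congr fun k => ?_
  exact (hasSum_inner h (v k) (v k)).tsum_eq

/-- Parseval in each rank-one term after exchanging sums; the right side no longer involves the
basis. -/
theorem tsum_inner_eq_tsum {J : Type u} {a b : J → H} (hs : Summable fun j => ‖a j‖ * ‖b j‖)
    (h : HasSum (fun j => rankOne ℂ (a j) (b j)) A) {K : Type*} (v : HilbertBasis K ℂ H) :
    ∑' k, inner ℂ (v k) (A (v k)) = ∑' j, inner ℂ (b j) (a j) := by
  have h1 : ∀ k, inner ℂ (v k) (A (v k)) = ∑' j, inner ℂ (v k) (a j) * inner ℂ (b j) (v k) :=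
    fun k => (hasSum_inner h (v k) (v k)).tsum_eq.symm
  have h2 : ∀ j, ∑' k, inner ℂ (v k) (a j) * inner ℂ (b j) (v k) = inner ℂ (b j) (a j) := fun j => by
    simp_rw [mul_comm (inner ℂ (v _) (a j))]
    exact v.tsum_inner_mul_inner (b j) (a j)
  simp_rw [h1, ← h2]
  have h3 := summable_prod (K := K) (v := fun k => v k) v.orthonormal hs
  exact Summable.tsum_comm (f := fun j k => inner ℂ (v k) (a j) * inner ℂ (b j) (v k)) h3

/-- The trace of a nuclear operator does not depend on the Hilbert basis. -/
theorem tsum_inner_eq (hA : IsNuclear A) {K K' : Type*} (v : HilbertBasis K ℂ H)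
    (w : HilbertBasis K' ℂ H) :
    ∑' k, inner ℂ (v k) (A (v k)) = ∑' k, inner ℂ (w k) (A (w k)) := by
  obtain ⟨J, a, b, hs, h⟩ := hA
  rw [tsum_inner_eq_tsum hs h, tsum_inner_eq_tsum hs h]

end IsNuclear

end Nuclear

end

/-! ### Kramers degeneracy. -/

section

open Module

/-- Kramers degeneracy: a finite-dimensional complex space with a conjugate-linear map of
square `-1` has even dimension. -/
theorem even_finrank_of_conjLinear_sq_eq_neg {V : Type*} [AddCommGroup V] [Module ℂ V]
    [FiniteDimensional ℂ V] (J : V →ₛₗ[starRingEnd ℂ] V) (hJ : ∀ v, J (J v) = -v) :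
    Even (finrank ℂ V) := by
  let b := finBasis ℂ V
  let A : Matrix (Fin (finrank ℂ V)) (Fin (finrank ℂ V)) ℂ := fun k i => b.repr (J (b i)) k
  -- `J` is `A` composed with coordinatewise conjugation, so `J² = -1` reads `A * conj A = -1`.
  -- Determinants give `|det A|² = (-1)^n`, which excludes odd `n`.
  have hA : A * A.map (starRingEnd ℂ) = -1 := by
    ext l i
    have h1 : J (b i) = ∑ k, A k i • b k := (b.sum_repr _).symm
    have h2 : -b i = ∑ k, (starRingEnd ℂ) (A k i) • J (b k) := by
      rw [← hJ (b i)]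
      conv_lhs => rw [h1]
      simp only [map_sum, map_smulₛₗ]
    have h3 := congrArg (fun v => b.repr v l) h2
    simp only [map_neg, map_sum, map_smul, Finsupp.coe_neg, Pi.neg_apply, Basis.repr_self,
      Finsupp.coe_finsetSum, Finset.sum_apply, Finsupp.coe_smul, Pi.smul_apply, smul_eq_mul] at h3
    rw [Matrix.mul_apply, Matrix.neg_apply, Matrix.one_apply]
    rw [Finsupp.single_apply] at h3
    simp only [eq_comm (a := l)]
    rw [h3]
    exact Finset.sum_congr rfl fun k _ => mul_comm _ _
  have hdet := congrArg Matrix.det hA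
  rw [Matrix.det_mul, Matrix.det_neg, Matrix.det_one, mul_one, Fintype.card_fin] at hdet
  have h4 : (A.map (starRingEnd ℂ)).det = (starRingEnd ℂ) A.det :=
    ((starRingEnd ℂ).map_det A).symm
  rw [h4, Complex.mul_conj] at hdet
  by_contra hodd
  rw [Nat.not_even_iff_odd] at hodd
  rw [hodd.neg_one_pow] at hdet
  have h5 : Complex.normSq A.det = -1 := by exact_mod_cast hdet
  linarith [Complex.normSq_nonneg A.det]

section Pair

variable {H : Type*} [NormedAddCommGroup H] [InnerProductSpace ℂ H]

/-- A projection that commutes with an antiunitary of square `-1` has even trace on every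
finite-dimensional subspace invariant under both. -/
theorem exists_tsum_inner_idempotent_eq_two_mul {P : H →L[ℂ] H} (hP : IsIdempotentElem P)
    (Θ : H ≃ₗᵢ⋆[ℂ] H) (hΘ : ∀ ψ, Θ (Θ ψ) = -ψ) (hPΘ : ∀ ψ, Θ (P ψ) = P (Θ ψ))
    (F : Submodule ℂ H) [FiniteDimensional ℂ F] (hPF : ∀ x ∈ F, P x ∈ F) (hΘF : ∀ x ∈ F, Θ x ∈ F)
    {K : Type*} (v : HilbertBasis K ℂ F) :
    ∃ m : ℤ, ∑' k, inner ℂ ((v k : F) : H) (P (v k)) = 2 * (m : ℂ) := by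
  have hPP : ∀ x, P (P x) = P x := fun x => congrArg (fun T : H →L[ℂ] H => T x) hP
  have : Finite K := by
    have := v.orthonormal.linearIndependent
    exact this.finite
  have := Fintype.ofFinite K
  let T : F →ₗ[ℂ] F := P.toLinearMap.restrict hPF
  -- `V` is the fixed space of `P` in `F`: its dimension is the trace, and `Θ` preserves it.
  let V : Submodule ℂ F := LinearMap.eqLocus T LinearMap.id
  have hV : LinearMap.IsProj V T :=
    ⟨fun x => Subtype.ext (hPP x), fun x hx => hx⟩
  let J : F →ₛₗ[starRingEnd ℂ] F :=
    { toFun := fun x => ⟨Θ x, hΘF x x.2⟩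
      map_add' := fun x y => Subtype.ext (by simp)
      map_smul' := fun c x => Subtype.ext (Θ.map_smulₛₗ c (x : H)) }
  have hJV : ∀ x ∈ V, J x ∈ V := fun x hx => by
    have h1 : P x = x := congrArg Subtype.val hx
    refine Subtype.ext ?_
    change P (Θ x) = Θ x
    rw [← hPΘ, h1]
  have heven : Even (finrank ℂ V) :=
    even_finrank_of_conjLinear_sq_eq_neg (J.restrict hJV)
      fun x => Subtype.ext (Subtype.ext (by exact hΘ x))
  obtain ⟨m, hm⟩ := heven
  refine ⟨m, ?_⟩
  have htr := hV.trace
  rw [LinearMap.trace_eq_sum_inner T v.toOrthonormalBasis, hm] at htr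
  rw [tsum_fintype]
  simp only [HilbertBasis.coe_toOrthonormalBasis] at htr
  push_cast at htr
  rw [two_mul, ← Int.cast_natCast (R := ℂ)] at *
  exact htr

end Pair

end

/-! ### Trace of a nuclear difference of two projections. -/

section

open Module

/-- Summable terms are eventually of norm below `2`, and an even integer of norm below `2` is zero,
so the sum is finite. -/
theorem exists_tsum_two_mul_intCast {ι : Type*} (g : ι → ℂ) (hg : Summable g)
    (h : ∀ i, ∃ m : ℤ, g i = 2 * (m : ℂ)) : ∃ m : ℤ, ∑' i, g i = 2 * (m : ℂ) := by
  choose m hm using h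
  have hfin : {i | ¬ ‖g i‖ < 2}.Finite := by
    have := hg.tendsto_cofinite_zero.norm
    rw [norm_zero] at this
    exact this.eventually (gt_mem_nhds two_pos)
  have hz : ∀ i, i ∉ hfin.toFinset → g i = 0 := fun i hi => by
    simp only [Set.Finite.mem_toFinset, Set.mem_ofPred_eq, not_not] at hi
    rw [hm i, norm_mul, Complex.norm_intCast, Complex.norm_ofNat] at hi
    have h1 : |(m i : ℝ)| < 1 := by linarith
    have h2 : m i = 0 := by
      rw [← Int.abs_lt_one_iff]; exact_mod_cast h1
    rw [hm i, h2]; simp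
  refine ⟨∑ i ∈ hfin.toFinset, m i, ?_⟩
  rw [tsum_eq_sum hz, Int.cast_sum, Finset.mul_sum]
  exact Finset.sum_congr rfl fun i _ => hm i

section

variable {H : Type*} [NormedAddCommGroup H] [InnerProductSpace ℂ H] [CompleteSpace H]

/-- A compact self-adjoint operator has a Hilbert basis made of Hilbert bases of its
eigenspaces. -/
theorem exists_hilbertBasis_eigenspaces {T : H →L[ℂ] H} (hT : IsCompactOperator T)
    (hT' : T.IsSymmetric) :
    ∃ (w : ∀ μ : ℂ, Set (End.eigenspace (T : End ℂ H) μ))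
      (b : ∀ μ, HilbertBasis (w μ) ℂ (End.eigenspace (T : End ℂ H) μ))
      (v : HilbertBasis (Σ μ, w μ) ℂ H), ∀ p, v p = (b p.1 p.2 : H) := by
  have hclosed : ∀ μ : ℂ, IsClosed (End.eigenspace (T : End ℂ H) μ : Set H) := fun μ => by
    have : (End.eigenspace (T : End ℂ H) μ : Set H) = {x | T x = μ • x} := by
      ext x; exact End.mem_eigenspace_iff
    rw [this]
    exact isClosed_eq T.continuous (continuous_const_smul μ)
  have hcomplete : ∀ μ : ℂ, CompleteSpace (End.eigenspace (T : End ℂ H) μ) := fun μ =>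
    (hclosed μ).completeSpace_coe
  choose w b hb using fun μ : ℂ => exists_hilbertBasis ℂ (End.eigenspace (T : End ℂ H) μ)
  have horth : Orthonormal ℂ fun p : Σ μ, w μ => ((b p.1 p.2 : End.eigenspace (T : End ℂ H) p.1) : H) :=
    hT'.orthogonalFamily_eigenspaces.orthonormal_sigma_orthonormal fun μ => (b μ).orthonormal
  refine ⟨w, b, HilbertBasis.mkOfOrthogonalEqBot horth ?_, fun p => ?_⟩
  · rw [eq_bot_iff, ← ContinuousLinearMap.orthogonalComplement_iSup_eigenspaces_eq_bot hT hT',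
      ← Submodule.iInf_orthogonal]
    intro x hx
    rw [Submodule.mem_iInf]
    intro μ
    rw [Submodule.mem_orthogonal']
    intro y hy
    have h0 : (innerSL ℂ x).comp (End.eigenspace (T : End ℂ H) μ).subtypeL = 0 := by
      refine ContinuousLinearMap.ext_on
        (Submodule.dense_iff_topologicalClosure_eq_top.2 (b μ).dense_span) ?_
      rintro _ ⟨k, rfl⟩
      exact (Submodule.mem_orthogonal' _ _).1 hx _ (Submodule.subset_span ⟨⟨μ, k⟩, rfl⟩)
    exact congrArg (fun f : End.eigenspace (T : End ℂ H) μ →L[ℂ] ℂ => f ⟨y, hy⟩) h0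
  · rw [HilbertBasis.coe_mkOfOrthogonalEqBot]

/-- The trace of a nuclear difference of two projections that commute with an antiunitary
operator of square `-1` is an even integer. -/
theorem exists_tsum_inner_sub_eq_two_mul {P Q : H →L[ℂ] H} (hP : IsStarProjection P)
    (hQ : IsStarProjection Q) (Θ : H ≃ₗᵢ⋆[ℂ] H) (hΘ : ∀ ψ, Θ (Θ ψ) = -ψ)
    (hPΘ : ∀ ψ, Θ (P ψ) = P (Θ ψ)) (hQΘ : ∀ ψ, Θ (Q ψ) = Q (Θ ψ)) (hPQ : IsNuclear (P - Q))
    {K : Type*} (e : HilbertBasis K ℂ H) :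
    ∃ m : ℤ, ∑' k, inner ℂ (e k) ((P - Q) (e k)) = 2 * (m : ℂ) := by
  set B := P - Q with hB
  have hBs : B.IsSymmetric := (hP.isSelfAdjoint.sub hQ.isSelfAdjoint).isSymmetric
  have hB2 : IsNuclear (B * B) := hPQ.mul_left B
  have hB2s : (B * B).IsSymmetric := fun x y => by
    change inner ℂ (B (B x)) y = inner ℂ x (B (B y))
    exact (hBs (B x) y).trans (hBs x (B y))
  have hPP := hP.isIdempotentElem.eq
  have hQQ := hQ.isIdempotentElem.eq
  -- Both sides equal `P - P * Q * P`.
  have hPB : P * (B * B) = B * B * P := by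
    simp only [hB, mul_sub, sub_mul, mul_assoc, hPP]
    simp only [← mul_assoc, hPP, hQQ]
    abel
  have hQB : Q * (B * B) = B * B * Q := by
    simp only [hB, mul_sub, sub_mul, mul_assoc, hQQ]
    simp only [← mul_assoc, hPP, hQQ]
    abel
  obtain ⟨T, hT⟩ : ∃ T, T = B * B := ⟨_, rfl⟩
  rw [← hT] at hB2 hB2s hPB hQB
  have hTx : ∀ x, T x = B (B x) := fun x => by rw [hT]; rfl
  obtain ⟨w, b, v, hv⟩ := exists_hilbertBasis_eigenspaces hB2.isCompactOperator hB2s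
  rw [hPQ.tsum_inner_eq e v]
  have hsum := hPQ.summable_inner v.orthonormal
  rw [hsum.tsum_sigma]
  refine exists_tsum_two_mul_intCast _ hsum.sigma fun μ => ?_
  have hmem : ∀ {x}, x ∈ End.eigenspace (T : End ℂ H) μ ↔ B (B x) = μ • x := by
    intro x
    rw [← hTx]
    exact End.mem_eigenspace_iff
  simp only [hv]
  -- Symmetry of `B` gives `ker B² = ker B`, so this infinite-dimensional eigenspace, if it is one,
  -- has zero diagonal.
  by_cases hμ : μ = 0
  · refine ⟨0, ?_⟩
    have h0 : ∀ k : w μ, B (b μ k : H) = 0 := fun k => by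
      have h1 : B (B (b μ k : H)) = 0 :=
        (hmem.1 (b μ k).2).trans (smul_eq_zero_of_left hμ _)
      rw [← inner_self_eq_zero (𝕜 := ℂ)]
      refine (hBs _ _).trans ?_
      change inner ℂ _ (B (B _)) = 0
      rw [h1, inner_zero_right]
    simp [h0]
  · have hfin : FiniteDimensional ℂ (End.eigenspace (T : End ℂ H) μ) :=
      ContinuousLinearMap.finite_dimensional_eigenspace hB2.isCompactOperator μ hμ
    have hinv : ∀ R : H →L[ℂ] H, R * (T) = T * R →
        ∀ x ∈ End.eigenspace (T : End ℂ H) μ,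
          R x ∈ End.eigenspace (T : End ℂ H) μ := fun R hR x hx => by
      have h1 : R (B (B x)) = B (B (R x)) := by
        rw [← hTx, ← hTx]
        exact congrArg (fun T : H →L[ℂ] H => T x) hR
      rw [hmem] at hx ⊢
      rw [← h1, hx, map_smul]
    have hΘF : ∀ x ∈ End.eigenspace (T : End ℂ H) μ,
        Θ x ∈ End.eigenspace (T : End ℂ H) μ := fun x hx => by
      by_cases hx0 : x = 0
      · simp [hx0]
      -- The antilinear `Θ` sends the eigenspace of `μ` to that of its conjugate; the eigenvalue is
      -- real.
      have hreal := hB2s.conj_eigenvalue_eq_self (End.hasEigenvalue_of_hasEigenvector ⟨hx, hx0⟩)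
      have hBΘ : ∀ y, Θ (B y) = B (Θ y) := fun y => by simp [hB, hPΘ, hQΘ]
      rw [hmem] at hx ⊢
      rw [← hBΘ, ← hBΘ, hx, Θ.map_smulₛₗ, hreal]
    obtain ⟨m₁, h₁⟩ := exists_tsum_inner_idempotent_eq_two_mul hP.isIdempotentElem Θ hΘ hPΘ _
      (hinv P hPB) hΘF (b μ)
    obtain ⟨m₂, h₂⟩ := exists_tsum_inner_idempotent_eq_two_mul hQ.isIdempotentElem Θ hΘ hQΘ _
      (hinv Q hQB) hΘF (b μ)
    have : Finite (w μ) := (b μ).orthonormal.linearIndependent.finite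
    refine ⟨m₁ - m₂, ?_⟩
    push_cast
    rw [mul_sub, ← h₁, ← h₂, ← Summable.tsum_sub (Summable.of_finite) (Summable.of_finite)]
    refine tsum_congr fun k => ?_
    rw [← inner_sub_right]
    rfl

end

end

/-! ### Spectrum and absolute value of self-adjoint nuclear operators. -/

section

open Module

section

variable {H : Type*} [NormedAddCommGroup H] [InnerProductSpace ℂ H]

namespace IsNuclear

variable {M : H →L[ℂ] H}

/-- Unit eigenvectors of distinct eigenvalues are orthonormal, so the eigenvalues occur as a
summable family of diagonal elements. -/
theorem finite_eigenvalues (hM : IsNuclear M) (hM' : M.IsSymmetric) {ε : ℝ} (hε : 0 < ε) :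
    {z : ℂ | End.HasEigenvalue (M : End ℂ H) z ∧ ε ≤ ‖z‖}.Finite := by
  have hx : ∀ z : {z : ℂ // End.HasEigenvalue (M : End ℂ H) z},
      ∃ x : End.eigenspace (M : End ℂ H) z, ‖x‖ = 1 := fun z => by
    have : Nontrivial (End.eigenspace (M : End ℂ H) z) :=
      Submodule.nontrivial_iff_ne_bot.2 (End.hasEigenvalue_iff.1 z.2)
    exact exists_norm_eq _ zero_le_one
  choose x hx using hx
  have ho : Orthonormal ℂ fun z => (x z : H) :=
    ⟨hx, fun z w hzw => hM'.orthogonalFamily_eigenspaces (fun h => hzw (Subtype.ext h)) (x z) (x w)⟩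
  have hsum := hM.summable_inner ho
  have hval : ∀ z, inner ℂ (x z : H) (M (x z : H)) = z := fun z => by
    have h1 : M (x z : H) = (z : ℂ) • (x z : H) := End.mem_eigenspace_iff.1 (x z).2
    have h2 : ‖(x z : H)‖ = 1 := hx z
    rw [h1, inner_smul_right, inner_self_eq_norm_sq_to_K, h2]
    simp
  simp only [hval] at hsum
  have h := hsum.tendsto_cofinite_zero.norm
  rw [norm_zero] at h
  have hfin : {z : {z : ℂ // End.HasEigenvalue (M : End ℂ H) z} | ¬ ‖(z : ℂ)‖ < ε}.Finite :=
    h.eventually (gt_mem_nhds hε)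
  refine (hfin.image Subtype.val).subset ?_
  rintro z ⟨hz, hz'⟩
  exact ⟨⟨z, hz⟩, not_lt.2 hz', rfl⟩

variable [CompleteSpace H]

theorem finite_spectrum (hM : IsNuclear M) (hM' : IsSelfAdjoint M) {ε : ℝ} (hε : 0 < ε) :
    {t ∈ spectrum ℝ M | ε ≤ |t|}.Finite := by
  refine ((hM.finite_eigenvalues hM'.isSymmetric hε).preimage
    Complex.ofReal_injective.injOn).subset ?_
  rintro t ⟨ht, htε⟩
  have ht0 : (t : ℂ) ≠ 0 := by
    rw [Ne, Complex.ofReal_eq_zero]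
    rintro rfl
    simp at htε
    linarith
  refine ⟨?_, by simpa using htε⟩
  rw [hM.isCompactOperator.hasEigenvalue_iff_mem_spectrum ht0]
  exact (spectrum.algebraMap_mem_iff ℂ).2 ht

/-- The absolute value of a self-adjoint nuclear operator is nuclear. -/
theorem opAbs (hM : IsNuclear M) (hM' : IsSelfAdjoint M) : IsNuclear (opAbs M) := by
  obtain ⟨w, b, v, hv⟩ := exists_hilbertBasis_eigenspaces hM.isCompactOperator hM'.isSymmetric
  have hMv : ∀ p, M (v p) = p.1 • v p := fun p => by
    rw [hv p]
    exact End.mem_eigenspace_iff.1 (b p.1 p.2).2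
  have hnorm : ∀ p, ‖v p‖ = 1 := v.orthonormal.norm_eq_one
  have hsum : Summable fun p : Σ μ, w μ => ‖p.1‖ := by
    refine (hM.summable_inner v.orthonormal).norm.congr fun p => ?_
    rw [hMv, inner_smul_right, inner_self_eq_norm_sq_to_K, hnorm]
    simp
  have hpos : (_root_.opAbs M).IsPositive :=
    (ContinuousLinearMap.nonneg_iff_isPositive _).1 (CFC.abs_nonneg M)
  have hsq : _root_.opAbs M * _root_.opAbs M = M * M := by
    have := CFC.abs_mul_abs M
    rwa [hM'.star_eq] at this
  have habs : ∀ p, _root_.opAbs M (v p) = (‖p.1‖ : ℂ) • v p := fun p => by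
    set T := _root_.opAbs M
    have hTT : ∀ x, T (T x) = M (M x) := fun x => congrArg (fun A : H →L[ℂ] H => A x) hsq
    have hreal : (starRingEnd ℂ) p.1 = p.1 :=
      hM'.isSymmetric.conj_eigenvalue_eq_self
        (End.hasEigenvalue_of_hasEigenvector
          ⟨End.mem_eigenspace_iff.2 (hMv p), v.orthonormal.ne_zero p⟩)
    have h2 : T (T (v p)) = ((‖p.1‖ : ℂ) * ‖p.1‖) • v p := by
      rw [hTT, hMv, map_smul, hMv, smul_smul]
      congr 1
      rw [← pow_two (‖p.1‖ : ℂ), ← Complex.conj_mul', hreal]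
    -- From `T² v = |λ|² v` it follows that `(T + |λ|) y = 0`; positivity of `T` forces `y = 0` when
    -- `λ ≠ 0`.
    set y := T (v p) - (‖p.1‖ : ℂ) • v p with hy
    have h3 : T y + (‖p.1‖ : ℂ) • y = 0 := by
      rw [hy, map_sub, map_smul, h2, smul_sub, smul_smul]
      abel
    have h4 : (inner ℂ y (T y)).re + ‖p.1‖ * ‖y‖ ^ 2 = 0 := by
      have := congrArg (fun z => (inner ℂ y z).re) h3
      simpa [inner_add_right, inner_smul_right, inner_self_eq_norm_sq_to_K, ← Complex.ofReal_pow]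
        using this
    have h5 : 0 ≤ (inner ℂ y (T y)).re := hpos.re_inner_nonneg_right y
    by_cases hp : p.1 = 0
    · have h6 : T (T (v p)) = 0 := by rw [h2, hp]; simp
      have h7 : T (v p) = 0 := by
        rw [← inner_self_eq_zero (𝕜 := ℂ)]
        refine (hpos.isSelfAdjoint.isSymmetric _ _).trans ?_
        change inner ℂ _ (T (T _)) = 0
        rw [h6, inner_zero_right]
      rw [h7, hp]; simp
    · have h6 : 0 < ‖p.1‖ := norm_pos_iff.2 hp
      have h7 : ‖y‖ ^ 2 = 0 := by
        have : 0 ≤ ‖p.1‖ * ‖y‖ ^ 2 := by positivity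
        have h8 : ‖p.1‖ * ‖y‖ ^ 2 = 0 := by linarith
        exact (mul_eq_zero.1 h8).resolve_left h6.ne'
      exact sub_eq_zero.1 (norm_eq_zero.1 (pow_eq_zero_iff two_ne_zero |>.1 h7))
  have hs : Summable fun p => ‖((‖p.1‖ : ℂ) • v p)‖ * ‖v p‖ := by
    simpa [norm_smul, hnorm] using hsum
  have hs' : Summable fun p => InnerProductSpace.rankOne ℂ ((‖p.1‖ : ℂ) • v p) (v p) :=
    Summable.of_norm (by simpa only [InnerProductSpace.norm_rankOne] using hs)
  refine ⟨_, _, _, hs, ?_⟩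
  convert hs'.hasSum using 1
  refine ContinuousLinearMap.ext_on
    (Submodule.dense_iff_topologicalClosure_eq_top.2 v.dense_span) ?_
  rintro _ ⟨p, rfl⟩
  have h1 := hs'.hasSum.mapL (ContinuousLinearMap.apply ℂ H (v p))
  refine (habs p).trans (HasSum.unique ?_ h1)
  convert hasSum_single p ?_ using 1
  · simp [inner_self_eq_norm_sq_to_K, hnorm]
  · intro q hq
    simp [v.orthonormal.inner_eq_zero hq]

end IsNuclear

end

end

/-! ### Spectral flattening. -/

section

open Module

section

variable {H : Type*} [NormedAddCommGroup H] [InnerProductSpace ℂ H]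

/-- Polarization: `Θ` preserves norms, and moving `I` through `Θ` changes its sign, which exchanges
the two imaginary terms. -/
theorem antiunitary_inner_map_map (Θ : H ≃ₗᵢ⋆[ℂ] H) (x y : H) :
    inner ℂ (Θ x) (Θ y) = inner ℂ y x := by
  have hI : ∀ z, Complex.I • Θ z = -Θ (Complex.I • z) := fun z => by
    rw [Θ.map_smulₛₗ]; simp
  rw [← inner_conj_symm y x, inner_eq_sum_norm_sq_div_four (𝕜 := ℂ) (Θ x),
    inner_eq_sum_norm_sq_div_four (𝕜 := ℂ) x]
  simp only [RCLike.I_to_complex, hI, ← sub_eq_add_neg, sub_neg_eq_add, ← map_add, ← map_sub,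
    Θ.norm_map]
  have h4 : (starRingEnd ℂ) 4 = 4 := map_ofNat _ 4
  simp [h4]
  ring

variable [CompleteSpace H]

theorem spectrum_sq_sub_self_mem {S : H →L[ℂ] H} (hS : IsSelfAdjoint S) {t : ℝ}
    (ht : t ∈ spectrum ℝ S) : t * t - t ∈ spectrum ℝ (S * S - S) := by
  have h : cfc (fun t : ℝ => t * t - t) S = S * S - S := by
    rw [cfc_sub (fun t : ℝ => t * t) (fun t => t) S, cfc_mul (fun t : ℝ => t) (fun t => t) S,
      cfc_id' ℝ S]
  rw [← h, cfc_map_spectrum (fun t : ℝ => t * t - t) S]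
  exact ⟨t, ht, rfl⟩

/-- If `S² - S` is nuclear, then the spectrum of `S` is discrete away from `0` and `1`. -/
theorem isFlattenable_of_isNuclear {S : H →L[ℂ] H} (hS : IsSelfAdjoint S)
    (hM : IsNuclear (S * S - S)) {μ : ℝ} (h0 : 0 < μ) (h1 : μ < 1) : IsFlattenable μ S := by
  refine ⟨hS, fun t ht => ?_⟩
  rcases lt_trichotomy t μ with h | rfl | h
  · refine (continuousAt_const.congr (f := fun _ => (0 : ℝ)) ?_).continuousWithinAt
    filter_upwards [gt_mem_nhds h] with u hu
    simp [flattenFun, hu.le]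
  · have hMs : IsSelfAdjoint (S * S - S) :=
      (by simpa [hS.star_eq] using IsSelfAdjoint.star_mul_self S : IsSelfAdjoint (S * S)).sub hS
    -- Only `t = μ` can be a jump. There `|t² - t| = 2ε > 0`, and few spectral points satisfy `|u² -
    -- u| ≥ ε`, so `t` is isolated in the spectrum.
    set ε : ℝ := t * (1 - t) / 2 with hε
    have hεpos : 0 < ε := by have := mul_pos h0 (sub_pos.2 h1); positivity
    have hfin : {u ∈ spectrum ℝ S | ε ≤ |u * u - u|}.Finite := by
      have hf := hM.finite_spectrum hMs hεpos
      have : {u ∈ spectrum ℝ S | ε ≤ |u * u - u|} ⊆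
          (fun u : ℝ => u * u - u) ⁻¹' {t ∈ spectrum ℝ (S * S - S) | ε ≤ |t|} :=
        fun u hu => ⟨spectrum_sq_sub_self_mem hS hu.1, hu.2⟩
      -- The fibres of `u ↦ u² - u` have at most two points, the roots of a quadratic equation.
      refine (hf.preimage' fun c _ => ?_).subset this
      refine (Set.toFinite {(1 + √(1 + 4 * c)) / 2, (1 - √(1 + 4 * c)) / 2}).subset ?_
      intro u hu
      have hu : u * u - u = c := hu
      have h4 : √(1 + 4 * c) = |2 * u - 1| := by
        rw [← Real.sqrt_sq_eq_abs, ← hu]; congr 1; ring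
      rw [h4]
      rcases abs_cases (2 * u - 1) with ⟨h, _⟩ | ⟨h, _⟩ <;> rw [h] <;> simp
    have hev : ∀ᶠ u in nhdsWithin t (spectrum ℝ S), u = t := by
      have hopen : ∀ᶠ u in nhds t, ε < |u * u - u| := by
        have hc : ContinuousAt (fun u : ℝ => |u * u - u|) t := by fun_prop
        refine hc.eventually (lt_mem_nhds ?_)
        have : |t * t - t| = t * (1 - t) := by
          rw [abs_sub_comm, abs_of_pos] <;> nlinarith
        change ε < |t * t - t|
        rw [this, hε]; linarith [mul_pos h0 (sub_pos.2 h1)]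
      have hcl : ∀ᶠ u in nhds t, u ∉ {u ∈ spectrum ℝ S | ε ≤ |u * u - u|} \ {t} :=
        (hfin.subset Set.sdiff_subset).isClosed.isOpen_compl.mem_nhds (by simp)
      filter_upwards [nhdsWithin_le_nhds hopen, nhdsWithin_le_nhds hcl, self_mem_nhdsWithin]
        with u hu hu' hus
      by_contra hne
      exact hu' ⟨⟨hus, hu.le⟩, hne⟩
    refine (continuousWithinAt_const (b := flattenFun t t)).congr_of_eventuallyEq ?_ rfl
    filter_upwards [hev] with u hu
    rw [hu]
  · refine (continuousAt_const.congr (f := fun _ => (1 : ℝ)) ?_).continuousWithinAt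
    filter_upwards [lt_mem_nhds h] with u hu
    simp [flattenFun, hu]

theorem isStarProjection_flatten {S : H →L[ℂ] H} {μ : ℝ} (hS : IsFlattenable μ S) :
    IsStarProjection (flatten μ S) := by
  obtain ⟨hS, hc⟩ := hS
  refine ⟨?_, cfc_predicate _ S⟩
  rw [IsIdempotentElem, flatten, ← cfc_mul (flattenFun μ) (flattenFun μ) S]
  congr 1
  ext t
  simp only [flattenFun]
  split_ifs <;> simp

theorem isNuclear_sub_flatten {S : H →L[ℂ] H} {μ : ℝ} (h0 : 0 < μ) (h1 : μ < 1)
    (hS : IsFlattenable μ S) (hM : IsNuclear (S * S - S)) : IsNuclear (S - flatten μ S) := by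
  obtain ⟨hS, hc⟩ := hS
  -- `g` is `1 / (t - 1)` below `μ` and `1 / t` above, so that `t - flattenFun μ t = g t * (t² -
  -- t)`. The `min` and `max` keep both denominators nonzero everywhere.
  let g : ℝ → ℝ := fun t =>
    (1 - flattenFun μ t) * (min t μ - 1)⁻¹ + flattenFun μ t * (max t μ)⁻¹
  have hg : ContinuousOn g (spectrum ℝ S) := by
    refine ((continuousOn_const.sub hc).mul (ContinuousOn.inv₀ (by fun_prop) ?_)).add
      (hc.mul (ContinuousOn.inv₀ (by fun_prop) ?_))
    · intro t _ h
      linarith [min_le_right t μ]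
    · intro t _ h
      linarith [le_max_right t μ]
  have hfac : S - flatten μ S = cfc g S * (S * S - S) := by
    have e1 : S - flatten μ S = cfc (fun t => t - flattenFun μ t) S := by
      rw [cfc_sub (fun t : ℝ => t) (flattenFun μ) S, cfc_id' ℝ S, flatten]
    have e2 : S * S - S = cfc (fun t : ℝ => t * t - t) S := by
      rw [cfc_sub (fun t : ℝ => t * t) (fun t => t) S, cfc_mul (fun t : ℝ => t) (fun t => t) S,
        cfc_id' ℝ S]
    rw [e1, e2, ← cfc_mul g (fun t : ℝ => t * t - t) S]
    congr 1
    ext t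
    simp only [g, flattenFun]
    split_ifs with h
    · rw [min_eq_left h]
      have : t - 1 ≠ 0 := by linarith
      field_simp
      ring
    · rw [max_eq_left (not_le.1 h).le]
      have : t ≠ 0 := by linarith
      field_simp
      ring
  rw [hfac]
  exact hM.mul_left _

theorem antiunitary_flatten_comm (Θ : H ≃ₗᵢ⋆[ℂ] H) {S : H →L[ℂ] H}
    (h : ∀ ψ, Θ (S ψ) = S (Θ ψ)) (μ : ℝ) (ψ : H) : Θ (flatten μ S ψ) = flatten μ S (Θ ψ) := by
  -- The commutant of an antilinear map is only a real algebra; this suffices because `flattenFun μ`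
  -- is real-valued. Antiunitarity gives closure under adjoints.
  let C : StarSubalgebra ℝ (H →L[ℂ] H) :=
    { carrier := {A | ∀ ψ, Θ (A ψ) = A (Θ ψ)}
      mul_mem' := fun {A B} hA hB ψ => (hA _).trans (congrArg A (hB ψ))
      add_mem' := fun {A B} hA hB ψ => by
        rw [add_apply, map_add, hA, hB]; rfl
      algebraMap_mem' := fun r ψ => by
        rw [Algebra.algebraMap_eq_smul_one]
        change Θ (r • ψ) = r • Θ ψ
        rw [← Complex.coe_smul r ψ, Θ.map_smulₛₗ, Complex.conj_ofReal, Complex.coe_smul]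
      star_mem' := fun {A} hA ψ => by
        refine ext_inner_left ℂ fun φ => ?_
        obtain ⟨χ, rfl⟩ := Θ.surjective φ
        rw [antiunitary_inner_map_map, ContinuousLinearMap.star_eq_adjoint,
          ContinuousLinearMap.adjoint_inner_left, ContinuousLinearMap.adjoint_inner_right, ← hA,
          antiunitary_inner_map_map] }
  have hC : IsClosed (C : Set (H →L[ℂ] H)) := by
    have : (C : Set (H →L[ℂ] H)) = ⋂ ψ, {A : H →L[ℂ] H | Θ (A ψ) = A (Θ ψ)} := by
      ext A; simp only [Set.mem_iInter]; rfl
    rw [this]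
    refine isClosed_iInter fun ψ => isClosed_eq ?_ ?_
    · exact Θ.continuous.comp (ContinuousLinearMap.apply ℂ H ψ).continuous
    · exact (ContinuousLinearMap.apply ℂ H (Θ ψ)).continuous
  exact StarAlgebra.elemental.le_of_mem hC (show S ∈ C from h) (cfc_mem_elemental _ S) ψ

end

end

/-! ### The site basis and operators given by their matrices. -/

section

variable {Λ : Set ℂ} {N : ℕ}

/-- The site basis as a Hilbert basis. -/
noncomputable def siteBasis (Λ : Set ℂ) (N : ℕ) :
    HilbertBasis (Λ × Fin N) ℂ (LatticeSpace Λ N) :=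
  HilbertBasis.ofRepr (LinearIsometryEquiv.refl ℂ _)

theorem siteBasis_apply (i : Λ × Fin N) : siteBasis Λ N i = siteKet i :=
  ((siteBasis Λ N).repr_symm_single i).symm

theorem orthonormal_siteKet : Orthonormal ℂ (siteKet : Λ × Fin N → LatticeSpace Λ N) := by
  have := (siteBasis Λ N).orthonormal
  rwa [funext siteBasis_apply] at this

theorem dense_span_siteKet :
    Dense (Submodule.span ℂ (Set.range (siteKet : Λ × Fin N → LatticeSpace Λ N)) :
      Set (LatticeSpace Λ N)) := by
  have := (siteBasis Λ N).dense_span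
  rw [funext siteBasis_apply] at this
  exact Submodule.dense_iff_topologicalClosure_eq_top.2 this

theorem ext_inner_siteKet {φ ψ : LatticeSpace Λ N}
    (h : ∀ i, inner ℂ (siteKet i) φ = inner ℂ (siteKet i) ψ) : φ = ψ := by
  refine (siteBasis Λ N).repr.injective (lp.ext (funext fun i => ?_))
  rw [HilbertBasis.repr_apply_apply, HilbertBasis.repr_apply_apply, siteBasis_apply]
  exact h i

theorem LatticeOp.ext_matEl {A B : LatticeOp Λ N} (h : ∀ i j, matEl A i j = matEl B i j) :
    A = B := by
  refine ContinuousLinearMap.ext_on dense_span_siteKet ?_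
  rintro _ ⟨j, rfl⟩
  exact ext_inner_siteKet fun i => h i j

theorem matEl_sub (A B : LatticeOp Λ N) (i j : Λ × Fin N) :
    matEl (A - B) i j = matEl A i j - matEl B i j := by
  simp [matEl]

theorem isSelfAdjoint_of_matEl {A : LatticeOp Λ N} (h : ∀ i j, matEl A j i = star (matEl A i j)) :
    IsSelfAdjoint A := by
  refine LatticeOp.ext_matEl fun i j => ?_
  rw [ContinuousLinearMap.star_eq_adjoint, matEl, ContinuousLinearMap.adjoint_inner_right,
    ← inner_conj_symm]
  exact (h j i).symm

theorem matEl_of_isSelfAdjoint {A : LatticeOp Λ N} (hA : IsSelfAdjoint A) (i j : Λ × Fin N) :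
    matEl A j i = star (matEl A i j) := by
  rw [matEl, matEl, ← hA.isSymmetric.apply_clm, RCLike.star_def, inner_conj_symm]

/-- An absolutely summable matrix defines a nuclear operator. -/
theorem exists_isNuclear_matEl (k : Λ × Fin N → Λ × Fin N → ℂ)
    (hk : Summable fun p : (Λ × Fin N) × (Λ × Fin N) => ‖k p.1 p.2‖) :
    ∃ K : LatticeOp Λ N, IsNuclear K ∧ ∀ i j, matEl K i j = k i j := by
  have hs : Summable fun p : (Λ × Fin N) × (Λ × Fin N) =>
      ‖k p.1 p.2 • (siteKet p.1 : LatticeSpace Λ N)‖ * ‖(siteKet p.2 : LatticeSpace Λ N)‖ := by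
    simpa [norm_smul, orthonormal_siteKet.norm_eq_one] using hk
  have hs' : Summable fun p : (Λ × Fin N) × (Λ × Fin N) =>
      InnerProductSpace.rankOne ℂ (k p.1 p.2 • (siteKet p.1 : LatticeSpace Λ N)) (siteKet p.2) :=
    Summable.of_norm (by simpa only [InnerProductSpace.norm_rankOne] using hs)
  refine ⟨_, ⟨_, _, _, hs, hs'.hasSum⟩, fun i j => ?_⟩
  refine (IsNuclear.hasSum_inner hs'.hasSum (siteKet i) (siteKet j)).unique ?_
  convert hasSum_single (i, j) ?_ using 1
  · simp [orthonormal_siteKet.norm_eq_one]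
  · rintro ⟨i', j'⟩ hne
    by_cases h1 : i = i'
    · have h2 : j' ≠ j := fun h2 => hne (by rw [h1, h2])
      simp [orthonormal_siteKet.inner_eq_zero h2]
    · simp [orthonormal_siteKet.inner_eq_zero h1]

/-- The states localized at the site `x`. -/
noncomputable def siteSubspace (N : ℕ) (x : Λ) : Submodule ℂ (LatticeSpace Λ N) :=
  Submodule.span ℂ (Set.range fun a : Fin N => siteKet (x, a))

theorem siteKet_mem_siteSubspace (i : Λ × Fin N) : siteKet i ∈ siteSubspace N i.1 :=
  Submodule.subset_span ⟨i.2, rfl⟩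

theorem HilbertBasis.mem_of_inner_eq_zero {ι H : Type*} [NormedAddCommGroup H]
    [InnerProductSpace ℂ H] (b : HilbertBasis ι ℂ H) {V : Submodule ℂ H} {s : Finset ι}
    (hs : ∀ i ∈ s, b i ∈ V) {ψ : H} (h : ∀ i ∉ s, inner ℂ (b i) ψ = 0) : ψ ∈ V := by
  have h2 : ∑ i ∈ s, b.repr ψ i • b i = ψ := by
    refine HasSum.unique (hasSum_sum_of_ne_finset_zero fun i hi => ?_) (b.hasSum_repr ψ)
    rw [b.repr_apply_apply, h i hi, zero_smul]
  rw [← h2]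
  exact Submodule.sum_mem _ fun i hi => Submodule.smul_mem _ _ (hs i hi)

theorem mem_siteSubspace {x : Λ} {ψ : LatticeSpace Λ N}
    (h : ∀ i : Λ × Fin N, i.1 ≠ x → inner ℂ (siteKet i) ψ = 0) : ψ ∈ siteSubspace N x := by
  classical
  refine (siteBasis Λ N).mem_of_inner_eq_zero (s := Finset.univ.image fun a : Fin N => (x, a))
    (fun i hi => ?_) fun i hi => ?_
  · obtain ⟨a, -, ha⟩ := Finset.mem_image.1 hi
    rw [siteBasis_apply, ← ha]
    exact Submodule.subset_span ⟨a, rfl⟩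
  · rw [siteBasis_apply]
    refine h i fun hx => hi (Finset.mem_image.2 ⟨i.2, Finset.mem_univ _, ?_⟩)
    rw [← hx]

/-- The phase depends on the sites only, so it survives the mixing of internal states by an on-site
`Θ`. -/
theorem inner_eq_mul_inner_of_matEl {P S : LatticeOp Λ N} {t : Λ → Λ → ℂ}
    (hS : ∀ i j, matEl S i j = t i.1 j.1 * matEl P i j) {x y : Λ} {φ ψ : LatticeSpace Λ N}
    (hφ : φ ∈ siteSubspace N x) (hψ : ψ ∈ siteSubspace N y) :
    inner ℂ φ (S ψ) = t x y * inner ℂ φ (P ψ) := by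
  induction hφ using Submodule.span_induction with
  | mem φ h =>
    obtain ⟨a, rfl⟩ := h
    induction hψ using Submodule.span_induction with
    | mem ψ h =>
      obtain ⟨b, rfl⟩ := h
      exact hS (x, a) (y, b)
    | zero => simp
    | add u v _ _ hu hv => simp only [map_add, inner_add_right, hu, hv, mul_add]
    | smul c u _ hu => simp only [map_smul, inner_smul_right, hu]; ring
  | zero => simp
  | add u v _ _ hu hv => simp only [inner_add_left, hu, hv, mul_add]
  | smul c u _ hu => simp only [inner_smul_left, hu]; ring

/-- If a time reversal commutes with `P`, it commutes with every operator that arises from `P` by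
real phases between the sites. -/
theorem timeReversal_comm_of_matEl {Θ : LatticeSpace Λ N ≃ₗᵢ⋆[ℂ] LatticeSpace Λ N}
    (hΘ : IsTimeReversal Θ) {P S : LatticeOp Λ N} (hPΘ : ∀ ψ, Θ (P ψ) = P (Θ ψ))
    {t : Λ → Λ → ℂ} (ht : ∀ x y, star (t x y) = t x y)
    (hS : ∀ i j, matEl S i j = t i.1 j.1 * matEl P i j) (ψ : LatticeSpace Λ N) :
    Θ (S ψ) = S (Θ ψ) := by
  have hmem : ∀ j, Θ (siteKet j) ∈ siteSubspace N j.1 := fun j =>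
    mem_siteSubspace fun i hi => hΘ.onsite i j hi
  have hflip : ∀ (A : LatticeOp Λ N) i j, inner ℂ (siteKet i) (Θ (A (siteKet j))) =
      -star (inner ℂ (Θ (siteKet i)) (A (siteKet j))) := fun A i j => by
    have h1 : siteKet i = Θ (-Θ (siteKet i)) := by rw [map_neg, hΘ.sq_eq_neg_one, neg_neg]
    conv_lhs => rw [h1]
    rw [antiunitary_inner_map_map, inner_neg_right, RCLike.star_def, inner_conj_symm]
  have hket : ∀ j, Θ (S (siteKet j)) = S (Θ (siteKet j)) := fun j => by
    refine ext_inner_siteKet fun i => ?_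
    rw [hflip, inner_eq_mul_inner_of_matEl hS (hmem i) (siteKet_mem_siteSubspace j),
      inner_eq_mul_inner_of_matEl hS (siteKet_mem_siteSubspace i) (hmem j), ← hPΘ, hflip, star_mul',
      ht]
    ring
  have h : ((Θ.toContinuousLinearEquiv : LatticeSpace Λ N →L⋆[ℂ] LatticeSpace Λ N).comp S) =
      S.comp (Θ.toContinuousLinearEquiv : LatticeSpace Λ N →L⋆[ℂ] LatticeSpace Λ N) := by
    refine ContinuousLinearMap.ext_on dense_span_siteKet ?_
    rintro _ ⟨j, rfl⟩
    exact hket j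
  exact congrArg (fun A : LatticeSpace Λ N →L⋆[ℂ] LatticeSpace Λ N => A ψ) h

/-- The unitary operator that multiplies the states at the site `x` by the phase `u x`. -/
theorem exists_gaugeTransformation (u : Λ → ℂ) (hu : ∀ x, ‖u x‖ = 1) :
    ∃ D : LatticeSpace Λ N ≃ₗᵢ[ℂ] LatticeSpace Λ N, ∀ i, D (siteKet i) = u i.1 • siteKet i := by
  have huu : ∀ x, star (u x) * u x = 1 := fun x => by
    rw [RCLike.star_def, Complex.conj_mul', hu]; simp
  have ho : Orthonormal ℂ fun i : Λ × Fin N => u i.1 • (siteKet i : LatticeSpace Λ N) := by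
    refine ⟨fun i => by rw [norm_smul, hu, orthonormal_siteKet.norm_eq_one, one_mul],
      fun i j hij => ?_⟩
    simp [inner_smul_left, inner_smul_right, orthonormal_siteKet.inner_eq_zero hij]
  have hsp : ⊤ ≤ (Submodule.span ℂ (Set.range fun i : Λ × Fin N =>
      u i.1 • (siteKet i : LatticeSpace Λ N))).topologicalClosure := by
    rw [← Submodule.dense_iff_topologicalClosure_eq_top.1 dense_span_siteKet]
    refine Submodule.topologicalClosure_mono (Submodule.span_le.2 ?_)
    rintro _ ⟨i, rfl⟩
    have h1 : (siteKet i : LatticeSpace Λ N) = star (u i.1) • u i.1 • siteKet i := by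
      rw [smul_smul, huu, one_smul]
    rw [h1]
    exact Submodule.smul_mem _ _ (Submodule.subset_span ⟨i, rfl⟩)
  refine ⟨(HilbertBasis.mk ho hsp).repr.symm, fun i => ?_⟩
  have := (HilbertBasis.mk ho hsp).repr_symm_single i
  rw [HilbertBasis.coe_mk] at this
  exact this

end

/-! ### Evenness from summability, and summability from decay. -/

section

variable {Λ : Set ℂ} {N : ℕ}

/-- If `P - S` has an absolutely summable matrix and `S` arises from `P` by signs between the
sites, then the trace over vertex states of `S` is an even integer. -/
theorem vertexTrace_even_of_summable {P S : LatticeOp Λ N} (hP : IsStarProjection P)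
    {Θ : LatticeSpace Λ N ≃ₗᵢ⋆[ℂ] LatticeSpace Λ N} (hΘ : IsTimeReversal Θ)
    (hPΘ : ∀ ψ, Θ (P ψ) = P (Θ ψ)) {t : Λ → Λ → ℂ} (ht : ∀ x y, star (t x y) = t x y)
    (htd : ∀ x, t x x = 1) (hSs : IsSelfAdjoint S)
    (hS : ∀ i j, matEl S i j = t i.1 j.1 * matEl P i j) (hK : IsNuclear (P - S))
    {μ : ℝ} (h0 : 0 < μ) (h1 : μ < 1) :
    IsFlattenable μ S ∧ IsTraceClass (S - flatten μ S) ∧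
      ∃ k : ℤ, vertexTrace μ S = 2 * (k : ℂ) := by
  have hM : IsNuclear (S * S - S) := by
    have h : S * S - S =
        (P - S) * (P - S) - P * (P - S) - (P - S) * P + (P - S) := by
      simp only [mul_sub, sub_mul, hP.isIdempotentElem.eq]
      abel
    rw [h]
    exact (((hK.mul_left _).sub (hK.mul_left _)).sub (hK.mul_right _)).add hK
  have hfl := isFlattenable_of_isNuclear hSs hM h0 h1
  have hA := isNuclear_sub_flatten h0 h1 hfl hM
  have hQ := isStarProjection_flatten hfl
  refine ⟨hfl, ?_, ?_⟩
  · have h := (hA.opAbs (hSs.sub hQ.isSelfAdjoint)).summable_inner orthonormal_siteKet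
    exact Complex.reCLM.summable h
  · have hB : IsNuclear (P - flatten μ S) := by
      have h : P - flatten μ S = (P - S) + (S - flatten μ S) := by abel
      rw [h]
      exact hK.add hA
    obtain ⟨m, hm⟩ := exists_tsum_inner_sub_eq_two_mul hP hQ Θ hΘ.sq_eq_neg_one hPΘ
      (antiunitary_flatten_comm Θ (timeReversal_comm_of_matEl hΘ hPΘ ht hS) μ) hB
      (siteBasis Λ N)
    refine ⟨m, ?_⟩
    rw [← hm, vertexTrace, opTrace]
    refine tsum_congr fun i => ?_
    rw [siteBasis_apply]
    change matEl _ i i = matEl _ i i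
    -- Since `t x x = 1`, replacing `S` by `P` leaves the diagonal unchanged.
    rw [matEl_sub, matEl_sub, hS, htd, one_mul]

theorem summable_exp_neg_mul_abs_int {c : ℝ} (hc : 0 < c) :
    Summable fun m : ℤ => Real.exp (-c * |(m : ℝ)|) := by
  have h : Summable fun n : ℕ => Real.exp (-c * n) := by
    have := Real.summable_exp_nat_mul_iff (a := -c).2 (by linarith)
    simpa [mul_comm] using this
  refine Summable.of_nat_of_neg ?_ ?_
  · simpa using h
  · simpa using h

/-- Exponentially decaying functions are summable over uniformly discrete sets. -/
theorem UniformlyDiscrete.summable_exp (hΛ : UniformlyDiscrete Λ) (O : ℂ) {c : ℝ} (hc : 0 < c) :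
    Summable fun x : Λ => Real.exp (-c * dist (x : ℂ) O) := by
  obtain ⟨δ, hδ, hsep⟩ := hΛ
  -- Two points in one square cell of side `r` are less than `2 * r = δ` apart, so each cell holds
  -- at most one site.
  set r := δ / 2 with hr
  have hrpos : 0 < r := by positivity
  let cell : Λ → ℤ × ℤ := fun x => (⌊((x : ℂ) - O).re / r⌋, ⌊((x : ℂ) - O).im / r⌋)
  have hcell : Function.Injective cell := by
    intro x y hxy
    by_contra hne
    have hd := hsep x x.2 y y.2 fun h => hne (Subtype.ext h)
    have h1 := Int.abs_sub_lt_one_of_floor_eq_floor (congrArg Prod.fst hxy)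
    have h2 := Int.abs_sub_lt_one_of_floor_eq_floor (congrArg Prod.snd hxy)
    rw [← sub_div, abs_div, abs_of_pos hrpos, div_lt_one hrpos] at h1 h2
    have h3 : dist (x : ℂ) y ≤ |((x : ℂ) - y).re| + |((x : ℂ) - y).im| := by
      rw [dist_eq_norm]; exact Complex.norm_le_abs_re_add_abs_im _
    have h4 : ((x : ℂ) - O).re - ((y : ℂ) - O).re = ((x : ℂ) - y).re := by simp
    have h5 : ((x : ℂ) - O).im - ((y : ℂ) - O).im = ((x : ℂ) - y).im := by simp
    rw [h4] at h1
    rw [h5] at h2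
    linarith
  -- The cell indices satisfy `r * (|m| + |n|) ≤ 2 * dist x O + 2 * r`; multiply by `c / 2`.
  set c' := c * r / 2 with hc'
  have hc'pos : 0 < c' := by positivity
  have hsum : Summable fun p : ℤ × ℤ =>
      Real.exp (-c' * |(p.1 : ℝ)|) * Real.exp (-c' * |(p.2 : ℝ)|) :=
    (summable_exp_neg_mul_abs_int hc'pos).mul_of_nonneg (summable_exp_neg_mul_abs_int hc'pos)
      (fun _ => (Real.exp_pos _).le) fun _ => (Real.exp_pos _).le
  refine Summable.of_nonneg_of_le (fun _ => (Real.exp_pos _).le) (fun x => ?_)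
    ((hsum.comp_injective hcell).mul_left (Real.exp (c * r)))
  simp only [Function.comp, cell]
  rw [← Real.exp_add, ← Real.exp_add, Real.exp_le_exp]
  have hfloor : ∀ a : ℝ, r * |(⌊a / r⌋ : ℝ)| ≤ |a| + r := fun a => by
    have e1 := Int.floor_le (a / r)
    have e2 := Int.lt_floor_add_one (a / r)
    have e3 : |(⌊a / r⌋ : ℝ) - a / r| ≤ 1 := by rw [abs_le]; constructor <;> linarith
    have e4 : |(⌊a / r⌋ : ℝ)| ≤ |a / r| + 1 := by
      linarith [abs_sub_abs_le_abs_sub (⌊a / r⌋ : ℝ) (a / r)]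
    rw [abs_div, abs_of_pos hrpos] at e4
    calc r * |(⌊a / r⌋ : ℝ)| ≤ r * (|a| / r + 1) := by gcongr
      _ = |a| + r := by field_simp
  have f1 := hfloor ((x : ℂ) - O).re
  have f2 := hfloor ((x : ℂ) - O).im
  have g1 := Complex.abs_re_le_norm ((x : ℂ) - O)
  have g2 := Complex.abs_im_le_norm ((x : ℂ) - O)
  rw [dist_eq_norm, hc']
  have h : r * |(⌊((x : ℂ) - O).re / r⌋ : ℝ)| + r * |(⌊((x : ℂ) - O).im / r⌋ : ℝ)| ≤
      2 * ‖(x : ℂ) - O‖ + 2 * r := by linarith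
  have := mul_le_mul_of_nonneg_left h hc.le
  nlinarith

/-- A matrix that is bounded by the decaying matrix of `P` and vanishes unless the distance of
the two sites controls their distance from `O` is absolutely summable. -/
theorem summable_of_expDecay (hΛ : UniformlyDiscrete Λ) {P : LatticeOp Λ N} (hP : ExpDecay P)
    (O : ℂ) (d : ℝ) (k : Λ × Fin N → Λ × Fin N → ℂ)
    (hk : ∀ i j, ‖k i j‖ ≤ 2 * ‖matEl P i j‖)
    (hk0 : ∀ i j : Λ × Fin N, k i j ≠ 0 →
      dist (i.1 : ℂ) O + dist (j.1 : ℂ) O ≤ 3 * dist (i.1 : ℂ) (j.1 : ℂ) + 2 * d) :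
    Summable fun p : (Λ × Fin N) × (Λ × Fin N) => ‖k p.1 p.2‖ := by
  obtain ⟨C₁, C₂, h1, h2, hd⟩ := hP
  -- The `3` is the factor of `dist i j` in `hk0`: the decay rate is shared between the distances of
  -- the two sites to `O`.
  set c := C₂ / 3 with hc
  have hcpos : 0 < c := by positivity
  have hs : Summable fun i : Λ × Fin N => Real.exp (-c * dist (i.1 : ℂ) O) := by
    have := (hΛ.summable_exp O hcpos).mul_of_nonneg (g := fun _ : Fin N => (1 : ℝ))
      (Summable.of_finite) (fun _ => (Real.exp_pos _).le) (fun _ => zero_le_one)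
    simpa using this
  have hs2 := (hs.mul_of_nonneg hs (fun _ => (Real.exp_pos _).le)
    (fun _ => (Real.exp_pos _).le)).mul_left (2 * C₁ * Real.exp (2 * c * d))
  refine Summable.of_nonneg_of_le (fun _ => norm_nonneg _) (fun p => ?_) hs2
  by_cases h0 : k p.1 p.2 = 0
  · rw [h0, norm_zero]; positivity
  · calc ‖k p.1 p.2‖ ≤ 2 * ‖matEl P p.1 p.2‖ := hk _ _
      _ ≤ 2 * (C₁ * Real.exp (-C₂ * dist (p.1.1 : ℂ) (p.2.1 : ℂ))) := by gcongr; exact hd _ _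
      _ ≤ 2 * (C₁ * Real.exp (2 * c * d + (-c * dist (p.1.1 : ℂ) O + -c * dist (p.2.1 : ℂ) O))) := by
          gcongr
          have := mul_le_mul_of_nonneg_left (hk0 _ _ h0) hcpos.le
          have e : C₂ = 3 * c := by rw [hc]; ring
          rw [e]
          nlinarith
      _ = _ := by rw [Real.exp_add, Real.exp_add]; ring

end

/-! ### The gauge that removes the fluxes between close sites. -/

section

open Relation

section

variable {Λ : Set ℂ}

/-- Two sites are close, relative to two points `O₁` and `O₂`, if their distance is less than the
distance of both from both points, and both are far from `O₁` relative to the distance of the two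
points. -/
def CloseTo (O₁ O₂ x y : ℂ) : Prop :=
  (dist x y < dist x O₁ ∧ dist x y < dist x O₂ ∧ dist O₁ O₂ < dist x O₁) ∧
    (dist x y < dist y O₁ ∧ dist x y < dist y O₂ ∧ dist O₁ O₂ < dist y O₁)

theorem CloseTo.symm {O₁ O₂ x y : ℂ} (h : CloseTo O₁ O₂ x y) : CloseTo O₁ O₂ y x := by
  simpa only [CloseTo, dist_comm y x] using And.symm h

/-- The constants come from the worst case, a site `x` with `dist x O₂ ≤ dist x y`: then `dist x O₁
≤ dist x y + dist O₁ O₂`, and `y` adds one more `dist x y`. -/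
theorem dist_add_dist_le_of_not_closeTo {O₁ O₂ x y : ℂ} (h : ¬ CloseTo O₁ O₂ x y) :
    dist x O₁ + dist y O₁ ≤ 3 * dist x y + 2 * dist O₁ O₂ := by
  have h1 := dist_triangle x y O₁
  have h2 := dist_triangle_left y O₁ x
  have h3 := dist_triangle_right x O₁ O₂
  have h4 := dist_triangle_right y O₁ O₂
  have h5 : 0 ≤ dist x y := dist_nonneg
  have h6 : 0 ≤ dist O₁ O₂ := dist_nonneg
  by_contra hc
  rw [not_le] at hc
  refine h ⟨⟨?_, ?_, ?_⟩, ?_, ?_, ?_⟩ <;> linarith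

theorem abs_arg_div_lt {z w : ℂ} (h : dist w z < ‖z‖) : |Complex.arg (w / z)| < Real.pi / 2 := by
  have hz : z ≠ 0 := norm_pos_iff.1 (dist_nonneg.trans_lt h)
  rw [Complex.abs_arg_lt_pi_div_two_iff]
  left
  have h1 : ‖w / z - 1‖ < 1 := by
    rw [div_sub_one hz, norm_div, ← dist_eq_norm, div_lt_one (norm_pos_iff.2 hz)]
    exact h
  have h2 := (abs_lt.1 ((Complex.abs_re_le_norm _).trans_lt h1)).1
  simp only [Complex.sub_re, Complex.one_re] at h2
  linarith

/-- Factor `(y - O₂) / (x - O₁)` through `x - O₂` or through `y - O₁`. All four arguments are below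
`π / 2` in modulus, so they add without a jump of `2π`. The right side is a difference of values at
the two ends and telescopes along a closed polygon. -/
theorem CloseTo.arg_sub_arg {O₁ O₂ x y : ℂ} (h : CloseTo O₁ O₂ x y) :
    Complex.arg ((y - O₂) / (x - O₂)) - Complex.arg ((y - O₁) / (x - O₁)) =
      Complex.arg ((y - O₂) / (y - O₁)) - Complex.arg ((x - O₂) / (x - O₁)) := by
  obtain ⟨⟨h1, h2, h3⟩, h4, h5, h6⟩ := h
  have hx1 : x - O₁ ≠ 0 := sub_ne_zero.2 (dist_pos.1 (dist_nonneg.trans_lt h1))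
  have hx2 : x - O₂ ≠ 0 := sub_ne_zero.2 (dist_pos.1 (dist_nonneg.trans_lt h2))
  have hy1 : y - O₁ ≠ 0 := sub_ne_zero.2 (dist_pos.1 (dist_nonneg.trans_lt h4))
  have hy2 : y - O₂ ≠ 0 := sub_ne_zero.2 (dist_pos.1 (dist_nonneg.trans_lt h5))
  have a1 : |Complex.arg ((y - O₂) / (x - O₂))| < Real.pi / 2 :=
    abs_arg_div_lt (by rwa [dist_sub_right, dist_comm, ← dist_eq_norm])
  have a2 : |Complex.arg ((y - O₁) / (x - O₁))| < Real.pi / 2 :=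
    abs_arg_div_lt (by rwa [dist_sub_right, dist_comm, ← dist_eq_norm])
  have a3 : |Complex.arg ((y - O₂) / (y - O₁))| < Real.pi / 2 :=
    abs_arg_div_lt (by rwa [dist_sub_left, dist_comm, ← dist_eq_norm])
  have a4 : |Complex.arg ((x - O₂) / (x - O₁))| < Real.pi / 2 :=
    abs_arg_div_lt (by rwa [dist_sub_left, dist_comm, ← dist_eq_norm])
  rw [abs_lt] at a1 a2 a3 a4
  have e1 := (Complex.arg_mul_eq_add_arg_iff (div_ne_zero hy2 hx2) (div_ne_zero hx2 hx1)).2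
    ⟨by linarith, by linarith⟩
  have e2 := (Complex.arg_mul_eq_add_arg_iff (div_ne_zero hy2 hy1) (div_ne_zero hy1 hx1)).2
    ⟨by linarith, by linarith⟩
  rw [div_mul_div_cancel₀ hx2] at e1
  rw [div_mul_div_cancel₀ hy1] at e2
  linarith

/-- Modulo `2π` the angles are differences of `arg (x k - O)` and telescope. -/
theorem exists_polygonWinding_eq (O : ℂ) {n : ℕ} {x : ℕ → Λ} (hx : x n = x 0)
    (hO : ∀ k ≤ n, (x k : ℂ) ≠ O) : ∃ w : ℤ, polygonWinding O n x = w := by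
  have h : ((∑ k ∈ Finset.range n, Complex.arg (((x (k + 1) : ℂ) - O) / ((x k : ℂ) - O)) : ℝ) :
      Real.Angle) = 0 := by
    rw [← Real.Angle.coe_coeHom, map_sum]
    simp only [Real.Angle.coe_coeHom]
    calc _ = ∑ k ∈ Finset.range n, ((Complex.arg ((x (k + 1) : ℂ) - O) : Real.Angle) -
          (Complex.arg ((x k : ℂ) - O) : Real.Angle)) := Finset.sum_congr rfl fun k hk => by
            have hk := Finset.mem_range.1 hk
            exact Complex.arg_div_coe_angle (sub_ne_zero.2 (hO _ hk)) (sub_ne_zero.2 (hO _ hk.le))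
      _ = 0 := by
        rw [Finset.sum_range_sub fun k => (Complex.arg ((x k : ℂ) - O) : Real.Angle), hx, sub_self]
  obtain ⟨w, hw⟩ := Real.Angle.coe_eq_zero_iff.1 h
  refine ⟨w, ?_⟩
  rw [polygonWinding, ← hw, zsmul_eq_mul, mul_div_assoc, div_self Real.two_pi_pos.ne', mul_one]

theorem notMem_segment_of_dist_lt {O x y : ℂ} (h : dist x y < dist x O) : O ∉ segment ℝ x y := by
  intro hO
  have := dist_add_dist_of_mem_segment hO
  linarith [dist_nonneg (x := O) (y := y)]

/-- A closed polygon with close edges turns equally often around both points. -/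
theorem IsTwoHalfFluxPhase.loopPhase_eq_one {O₁ O₂ : ℂ} {s : Λ → Λ → ℂ}
    (hs : IsTwoHalfFluxPhase O₁ O₂ s) {n : ℕ} {x : ℕ → Λ} (hx : x n = x 0)
    (hc : ∀ k < n, CloseTo O₁ O₂ (x k) (x (k + 1))) : loopPhase s n x = 1 := by
  rcases Nat.eq_zero_or_pos n with rfl | hn
  · simp [loopPhase]
  have hne1 : ∀ k ≤ n, (x k : ℂ) ≠ O₁ := fun k hk => by
    rcases hk.lt_or_eq with hk | rfl
    · exact dist_pos.1 (dist_nonneg.trans_lt (hc k hk).1.1)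
    · rw [hx]; exact dist_pos.1 (dist_nonneg.trans_lt (hc 0 hn).1.1)
  have hne2 : ∀ k ≤ n, (x k : ℂ) ≠ O₂ := fun k hk => by
    rcases hk.lt_or_eq with hk | rfl
    · exact dist_pos.1 (dist_nonneg.trans_lt (hc k hk).1.2.1)
    · rw [hx]; exact dist_pos.1 (dist_nonneg.trans_lt (hc 0 hn).1.2.1)
  obtain ⟨w₁, hw₁⟩ := exists_polygonWinding_eq O₁ hx hne1
  have hw₂ : polygonWinding O₂ n x = w₁ := by
    rw [← hw₁, polygonWinding, polygonWinding]
    congr 1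
    rw [← sub_eq_zero, ← Finset.sum_sub_distrib]
    rw [Finset.sum_congr rfl fun k hk => (hc k (Finset.mem_range.1 hk)).arg_sub_arg,
      Finset.sum_range_sub fun k => Complex.arg (((x k : ℂ) - O₂) / ((x k : ℂ) - O₁)), hx, sub_self]
  rw [hs.loop n x hx (fun k hk => notMem_segment_of_dist_lt (hc k hk).1.1)
    (fun k hk => notMem_segment_of_dist_lt (hc k hk).1.2.1) w₁ w₁ hw₁ hw₂]
  exact (Even.add_self w₁).neg_one_zpow

/-- Parallel transport with the phases `s` along an edge in `C`. -/
def PhaseStep (s : Λ → Λ → ℂ) (C : Λ → Λ → Prop) (p q : Λ × ℂ) : Prop :=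
  C p.1 q.1 ∧ q.2 = p.2 * s p.1 q.1

/-- Turns chains of steps, which are easy to concatenate and reverse, into the indexed polygons of
the flux hypotheses. -/
theorem exists_polygon_of_phaseStep {s : Λ → Λ → ℂ} {C : Λ → Λ → Prop} {p q : Λ × ℂ}
    (h : ReflTransGen (PhaseStep s C) p q) :
    ∃ (n : ℕ) (x : ℕ → Λ), x 0 = p.1 ∧ x n = q.1 ∧ (∀ k < n, C (x k) (x (k + 1))) ∧
      q.2 = p.2 * loopPhase s n x := by
  induction h with
  | refl => exact ⟨0, fun _ => p.1, rfl, rfl, by simp, by simp [loopPhase]⟩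
  | @tail q r _ hqr ih =>
    obtain ⟨n, x, h0, hn, hC, hq⟩ := ih
    have hlt : ∀ k ≤ n, Function.update x (n + 1) r.1 k = x k := fun k hk =>
      Function.update_of_ne (by omega) _ _
    refine ⟨n + 1, Function.update x (n + 1) r.1, ?_, Function.update_self .., ?_, ?_⟩
    · rw [hlt 0 (Nat.zero_le _), h0]
    · intro k hk
      rw [hlt k (by omega)]
      rcases Nat.lt_succ_iff_lt_or_eq.1 hk with hk | rfl
      · rw [hlt (k + 1) hk]; exact hC k hk
      · rw [Function.update_self, hn]; exact hqr.1
    · rw [loopPhase, Finset.prod_range_succ, Function.update_self, hlt n le_rfl, hn, ← mul_assoc,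
        Finset.prod_congr rfl fun k hk => by
          have hk := Finset.mem_range.1 hk
          rw [hlt k hk.le, hlt (k + 1) hk], hqr.2, hq]
      rfl

theorem exists_phaseStep_lift (s : Λ → Λ → ℂ) {C : Λ → Λ → Prop} {x y : Λ}
    (h : ReflTransGen C x y) (a : ℂ) : ∃ b, ReflTransGen (PhaseStep s C) (x, a) (y, b) := by
  induction h with
  | refl => exact ⟨a, .refl⟩
  | @tail y z _ hyz ih =>
    obtain ⟨b, hb⟩ := ih
    exact ⟨b * s y z, hb.tail ⟨hyz, rfl⟩⟩

/-- There is a gauge in which all phases are real, and equal to `1` between close sites. -/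
theorem IsTwoHalfFluxPhase.exists_gauge {O₁ O₂ : ℂ} {s : Λ → Λ → ℂ}
    (hs : IsTwoHalfFluxPhase O₁ O₂ s) :
    ∃ e : Λ → ℂ, (∀ x, ‖e x‖ = 1) ∧ (∀ x y, e x * s x y = e y ∨ e x * s x y = -e y) ∧
      ∀ x y : Λ, CloseTo O₁ O₂ x y → e x * s x y = e y := by
  rcases isEmpty_or_nonempty Λ with hΛ | ⟨⟨o⟩⟩
  · exact ⟨isEmptyElim, isEmptyElim, isEmptyElim, isEmptyElim⟩
  let C : Λ → Λ → Prop := fun x y => CloseTo O₁ O₂ x y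
  have hCsymm : Std.Symm C := ⟨fun x y h => CloseTo.symm h⟩
  have hss : ∀ x y, s x y * s y x = 1 := fun x y => by
    rw [hs.conj_symm x y, RCLike.star_def, Complex.mul_conj', hs.norm_eq_one]; simp
  have hrev : ∀ {D : Λ → Λ → Prop}, (∀ x y, D x y → D y x) → ∀ {p q},
      ReflTransGen (PhaseStep s D) p q → ReflTransGen (PhaseStep s D) q p := by
    intro D hD p q h
    induction h with
    | refl => exact .refl
    | tail _ h ih =>
      refine ih.head ⟨hD _ _ h.1, ?_⟩
      rw [h.2, mul_assoc, hss, mul_one]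
  have hloop : ∀ {y : Λ} {a b : ℂ}, ReflTransGen (PhaseStep s C) (y, a) (y, b) → b = a := by
    intro y a b h
    obtain ⟨n, x, h0, hn, hC, hb⟩ := exists_polygon_of_phaseStep h
    rw [hs.loopPhase_eq_one (hn.trans h0.symm) hC, mul_one] at hb
    exact hb
  have hloop' : ∀ {y : Λ} {a b : ℂ},
      ReflTransGen (PhaseStep s fun _ _ => True) (y, a) (y, b) → b = a ∨ b = -a := by
    intro y a b h
    obtain ⟨n, x, h0, hn, -, hb⟩ := exists_polygon_of_phaseStep h
    rcases hs.loop_sign n x (hn.trans h0.symm) with h1 | h1 <;> rw [h1] at hb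
    · left; simpa using hb
    · right; simpa using hb
  have hnorm : ∀ {D : Λ → Λ → Prop} {p q}, ReflTransGen (PhaseStep s D) p q → ‖q.2‖ = ‖p.2‖ := by
    intro D p q h
    obtain ⟨n, x, -, -, -, hb⟩ := exists_polygon_of_phaseStep h
    rw [hb, norm_mul, loopPhase, norm_prod]
    simp [hs.norm_eq_one]
  let St : Setoid Λ :=
    { r := ReflTransGen C
      iseqv := ⟨fun _ => .refl, fun h => symm h, fun h h' => h.trans h'⟩ }
  let rep : Λ → Λ := fun x => (Quotient.mk St x).out
  have hrep : ∀ x, ReflTransGen C (rep x) x := fun x => Quotient.exact (Quotient.out_eq (Quotient.mk St x))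
  -- The closeness graph may be disconnected: jump directly from `o` to the representative of the
  -- component of `x`, then transport along close edges.
  choose e he using fun x => exists_phaseStep_lift s (hrep x) (s o (rep x))
  have he' : ∀ x, ReflTransGen (PhaseStep s fun _ _ => True) (o, 1) (x, e x) := fun x =>
    .head (b := (rep x, s o (rep x))) ⟨trivial, (one_mul _).symm⟩
      (ReflTransGen.mono (fun _ _ h => ⟨trivial, h.2⟩) _ _ (he x))
  refine ⟨e, fun x => ?_, fun x y => ?_, fun x y hxy => ?_⟩
  · rw [hnorm (he x), hs.norm_eq_one]
  · exact hloop' ((hrev (fun _ _ _ => trivial) (he' y)).trans ((he' x).tail ⟨trivial, rfl⟩))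
  · have h1 : rep y = rep x :=
      congrArg Quotient.out (Quotient.sound (s := St) (ReflTransGen.single hxy.symm))
    have h2 := he y
    rw [h1] at h2
    exact hloop ((hrev (fun _ _ h => h.symm) h2).trans ((he x).tail ⟨hxy, rfl⟩))

end

end

/-! ### Gauge transformation of `P`, and conclusion. -/

/-- Gauge transformation of a projection with time reversal symmetry. -/
theorem exists_gaugeTransform_projection {Λ : Set ℂ} {N : ℕ} {P : LatticeOp Λ N}
    (hP : IsStarProjection P) {Θ : LatticeSpace Λ N ≃ₗᵢ⋆[ℂ] LatticeSpace Λ N}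
    (hΘ : IsTimeReversal Θ) (hPΘ : ∀ ψ, Θ (P ψ) = P (Θ ψ)) {e : Λ → ℂ} (he : ∀ x, ‖e x‖ = 1) :
    ∃ (P' : LatticeOp Λ N) (Θ' : LatticeSpace Λ N ≃ₗᵢ⋆[ℂ] LatticeSpace Λ N),
      IsStarProjection P' ∧ IsTimeReversal Θ' ∧ (∀ ψ, Θ' (P' ψ) = P' (Θ' ψ)) ∧
        ∀ i j, matEl P' i j = star (e i.1) * e j.1 * matEl P i j := by
  have hee : ∀ x, star (e x) * e x = 1 := fun x => by
    rw [RCLike.star_def, Complex.conj_mul', he]; simp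
  obtain ⟨D, hD⟩ := exists_gaugeTransformation (N := N) (fun x => star (e x))
    fun x => by rw [norm_star, he]
  have hDsymm : ∀ i, D.symm (siteKet i) = e i.1 • siteKet i := fun i => by
    rw [LinearIsometryEquiv.symm_apply_eq, map_smul, hD, smul_smul, mul_comm, hee, one_smul]
  let P' : LatticeOp Λ N := (D : LatticeOp Λ N) * P * (D.symm : LatticeOp Λ N)
  have hP'ap : ∀ ψ, P' ψ = D (P (D.symm ψ)) := fun ψ => rfl
  have hP'el : ∀ i j, matEl P' i j = star (e i.1) * e j.1 * matEl P i j := fun i j => by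
    rw [matEl, hP'ap, ← LinearIsometryEquiv.inner_map_map D.symm, D.symm_apply_apply, hDsymm,
      hDsymm, map_smul, inner_smul_left, inner_smul_right, matEl, RCLike.star_def]
    ring
  have hP'sa : IsSelfAdjoint P' := isSelfAdjoint_of_matEl fun i j => by
    rw [hP'el, hP'el, matEl_of_isSelfAdjoint hP.isSelfAdjoint i j, star_mul', star_mul', star_star]
    ring
  have hP' : IsStarProjection P' := by
    refine ⟨ContinuousLinearMap.ext fun ψ => ?_, hP'sa⟩
    change P' (P' ψ) = P' ψ
    rw [hP'ap, hP'ap, D.symm_apply_apply]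
    congr 1
    exact congrArg (fun A : LatticeOp Λ N => A (D.symm ψ)) hP.isIdempotentElem
  let Θ' : LatticeSpace Λ N ≃ₗᵢ⋆[ℂ] LatticeSpace Λ N := (D.symm.trans Θ).trans D
  have hΘ'ap : ∀ ψ, Θ' ψ = D (Θ (D.symm ψ)) := fun ψ => rfl
  have hΘ' : IsTimeReversal Θ' := by
    refine ⟨fun ψ => ?_, fun i j hij => ?_⟩
    · rw [hΘ'ap, hΘ'ap, D.symm_apply_apply, hΘ.sq_eq_neg_one, map_neg, D.apply_symm_apply]
    · rw [hΘ'ap, ← LinearIsometryEquiv.inner_map_map D.symm, D.symm_apply_apply, hDsymm, hDsymm,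
        Θ.map_smulₛₗ, inner_smul_left, inner_smul_right, hΘ.onsite i j hij, mul_zero, mul_zero]
  have hP'Θ' : ∀ ψ, Θ' (P' ψ) = P' (Θ' ψ) := fun ψ => by
    rw [hΘ'ap, hΘ'ap, hP'ap, hP'ap, D.symm_apply_apply, D.symm_apply_apply, hPΘ]
  exact ⟨P', Θ', hP', hΘ', hP'Θ', hP'el⟩

theorem mainTheorem6 (Λ : Set ℂ) (hΛ : UniformlyDiscrete Λ) (N : ℕ)
    (P : LatticeOp Λ N) (hP : IsStarProjection P) (hdecay : ExpDecay P)
    (Θ : LatticeSpace Λ N ≃ₗᵢ⋆[ℂ] LatticeSpace Λ N) (hΘ : IsTimeReversal Θ)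
    (hPΘ : ∀ ψ, Θ (P ψ) = P (Θ ψ))
    (O₁ O₂ : ℂ) (s : Λ → Λ → ℂ) (hs : IsTwoHalfFluxPhase O₁ O₂ s) :
    (∃! S : LatticeOp Λ N, IsPeierls s P S) ∧
      ∀ S : LatticeOp Λ N, IsPeierls s P S →
        ∀ μ : ℝ, 0 < μ → μ < 1 →
          IsFlattenable μ S ∧
          IsTraceClass (S - flatten μ S) ∧
          ∃ k : ℤ, vertexTrace μ S = 2 * (k : ℂ) := by
  obtain ⟨e, he, hsign, hclose⟩ := hs.exists_gauge
  have hee : ∀ x, star (e x) * e x = 1 := fun x => by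
    rw [RCLike.star_def, Complex.conj_mul', he]; simp
  obtain ⟨P', Θ', hP', hΘ', hP'Θ', hP'el⟩ := exists_gaugeTransform_projection hP hΘ hPΘ he
  -- The gauge factors of `t` cancel those of `P'`, so `t * P' = s * P`: the operator `S` itself is
  -- not transformed.
  let t : Λ → Λ → ℂ := fun x y => e x * s x y * star (e y)
  have htval : ∀ x y, t x y = 1 ∨ t x y = -1 := fun x y => by
    rcases hsign x y with h | h
    · left; simp only [t]; rw [h, mul_comm, hee]
    · right; simp only [t]; rw [h, neg_mul, mul_comm, hee]
  have htclose : ∀ x y : Λ, CloseTo O₁ O₂ x y → t x y = 1 := fun x y h => by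
    simp only [t]; rw [hclose x y h, mul_comm, hee]
  have htstar : ∀ x y, star (t x y) = t x y := fun x y => by
    rcases htval x y with h | h <;> rw [h] <;> simp
  have htdiag : ∀ x, t x x = 1 := fun x => by
    simp only [t]; rw [hs.diag, mul_one, mul_comm, hee]
  have hst : ∀ i j, t i.1 j.1 * matEl P' i j = s i.1 j.1 * matEl P i j := fun i j => by
    rw [hP'el]
    calc _ = (star (e i.1) * e i.1) * (star (e j.1) * e j.1) * (s i.1 j.1 * matEl P i j) := by
          simp only [t]; ring
      _ = _ := by rw [hee, hee, one_mul, one_mul]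
  -- The matrix of `P' - S`. Building it first as a nuclear operator `K` yields the existence of `S`
  -- as `P' - K`.
  let k : Λ × Fin N → Λ × Fin N → ℂ := fun i j => (1 - t i.1 j.1) * matEl P' i j
  have hk : ∀ i j, ‖k i j‖ ≤ 2 * ‖matEl P i j‖ := fun i j => by
    simp only [k]
    rw [hP'el, norm_mul, norm_mul, norm_mul, norm_star, he, he, one_mul, one_mul]
    refine mul_le_mul_of_nonneg_right ?_ (norm_nonneg _)
    rcases htval i.1 j.1 with h | h <;> rw [h] <;> norm_num
  have hk0 : ∀ i j : Λ × Fin N, k i j ≠ 0 →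
      dist (i.1 : ℂ) O₁ + dist (j.1 : ℂ) O₁ ≤ 3 * dist (i.1 : ℂ) (j.1 : ℂ) + 2 * dist O₁ O₂ :=
    fun i j h => dist_add_dist_le_of_not_closeTo fun hc => h (by
      simp only [k]
      rw [htclose _ _ hc, sub_self, zero_mul])
  have hksum := summable_of_expDecay hΛ hdecay O₁ (dist O₁ O₂) k hk hk0
  obtain ⟨K, hK, hKel⟩ := exists_isNuclear_matEl k hksum
  have hel : ∀ i j, matEl (P' - K) i j = t i.1 j.1 * matEl P' i j := fun i j => by
    rw [matEl_sub, hKel]; simp only [k]; ring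
  have hS₀ : IsPeierls s P (P' - K) := fun i j => (hel i j).trans (hst i j)
  have huniq : ∀ S, IsPeierls s P S → S = P' - K := fun S hS =>
    LatticeOp.ext_matEl fun i j => (hS i j).trans (hS₀ i j).symm
  refine ⟨⟨P' - K, hS₀, huniq⟩, fun S hS μ h0 h1 => ?_⟩
  obtain rfl := huniq S hS
  have hSs : IsSelfAdjoint (P' - K) := isSelfAdjoint_of_matEl fun i j => by
    rw [hS₀, hS₀, matEl_of_isSelfAdjoint hP.isSelfAdjoint i j, hs.conj_symm, star_mul']
  exact vertexTrace_even_of_summable hP' hΘ' hP'Θ' htstar htdiag hSs hel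
    (by rwa [sub_sub_cancel]) h0 h1
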